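/- For $u\in L^2(0,1)$ (real-valued) let $$|u|_{TV}=\sup\Big\{\int_0^1 u\,\varphi'\,dx:\ \varphi\in C_c^\infty((0,1)),\ \|\varphi\|_\infty\le 1\Big\}\in[0,\infty].$$ For $\lambda>0$ and $f\in L^2(0,1)$ consider the TV-denoising (ROF/Tikhonov) functional $$F_{\lambda,f}(u)=\frac{\lambda}{2}\|u-f\|_{L^2(0,1)}^2+|u|_{TV},\qquad u\in L^2(0,1).$$ Let $y\in L^2(0,1)$ and let $(\lambda_n)_{n\in\mathbb N_0}$ be a (not necessarily strictly) increasing sequence of positive real numbers. The multiscale hierarchical decomposition method (MHDM) with data $y$ computes $$u_0\in\operatorname{argmin}F_{\lambda_0,y},\qquad x_0=u_0,\qquad u_n\in\operatorname{argmin}F_{\lambda_n,\,y-x_{n-1}},\qquad x_n=x_{n-1}+u_n\quad(n\ge 1).$$ Then for every $n\in\mathbb N_0$ the functional $F_{\lambda_n,y}$ has exactly one minimizer $x_{\lambda_n}$ in $L^2(0,1)$, the MHDM sequence $(u_n)_{n\in\mathbb N_0}$ exists and is unique, and the MHDM iterates agree with the Tikhonov minimizers: $$x_n=x_{\lambda_n}\qquad\text{for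 all } n\in\mathbb N_0 .$$ -/

import Mathlib

open MeasureTheory Set
open scoped ENNReal ContDiff

noncomputable section

namespace MHDM

section General

variable {X H : Type*} [NormedAddCommGroup X] [NormedSpace ℝ X]
  [NormedAddCommGroup H] [InnerProductSpace ℝ H]

/-- The generalized Tikhonov functional `F_l(u) = (l/2) ‖T u - f‖² + J(u)`, with values in `[0, ∞]`
(used for `l > 0`). -/
def tikhonov (T : X →L[ℝ] H) (J : X → ℝ≥0∞) (l : ℝ) (f : H) (u : X) : ℝ≥0∞ :=
  ENNReal.ofReal (l / 2 * ‖T u - f‖ ^ 2) + J u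

/-- `u` is a minimizer over `X` of the Tikhonov functional with parameter `l` and data `f`. -/
def IsTikhonovMinimizer (T : X →L[ℝ] H) (J : X → ℝ≥0∞) (l : ℝ) (f : H) (u : X) : Prop :=
  ∀ w : X, tikhonov T J l f u ≤ tikhonov T J l f w

/-- The iterate `x_n = u_0 + … + u_n` formed from the components `u_0, u_1, …`. -/
def iterate (u : ℕ → X) (n : ℕ) : X := ∑ i ∈ Finset.range (n + 1), u i

/-- `u_0, u_1, …` are components produced by the multiscale hierarchical decomposition method with
operator `T`, penalty `J`, parameters `lam n` and data `f`: `u_0` minimizes the Tikhonov functional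
with data `f` and parameter `lam 0`, and `u_{n+1}` minimizes the one whose data is the residual
`v_n = f - T x_n` and whose parameter is `lam (n + 1)`. -/
structure IsDecomposition (T : X →L[ℝ] H) (J : X → ℝ≥0∞) (lam : ℕ → ℝ) (f : H) (u : ℕ → X) :
    Prop where
  zero : IsTikhonovMinimizer T J (lam 0) f (u 0)
  succ : ∀ n : ℕ, IsTikhonovMinimizer T J (lam (n + 1)) (f - T (iterate u n)) (u (n + 1))

end General

/-- Real `L²` on the unit interval `(0, 1)` with Lebesgue measure. -/
abbrev L2 : Type := Lp ℝ 2 (volume.restrict (Ioo (0 : ℝ) 1))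

/-- Admissible test functions for the total variation on `(0, 1)`: smooth functions with compact
support in `(0, 1)` and sup norm at most one. -/
def IsTestFunction (φ : ℝ → ℝ) : Prop :=
  ContDiff ℝ ∞ φ ∧ HasCompactSupport φ ∧ tsupport φ ⊆ Ioo (0 : ℝ) 1 ∧ ∀ x, |φ x| ≤ 1

/-- The total variation seminorm `|u|_TV = sup { ∫ u φ' }` on `L²(0, 1)`, with value `∞` if `u` is
not of bounded variation. Cutting the integrals off at zero does not change the supremum, because
`φ = 0` is admissible. -/
def totalVariation (u : L2) : ℝ≥0∞ :=
  ⨆ φ : {φ : ℝ → ℝ // IsTestFunction φ},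
    ENNReal.ofReal (∫ x in Ioo (0 : ℝ) 1, u x * deriv φ.1 x)

end MHDM

end

namespace MHDM

open scoped RealInnerProductSpace

/-! The total variation is the support function of `dualBall 1`, the closed convex set of
derivatives of functions bounded by 1 that vanish at both endpoints. By duality, the minimizer with
data `f` and parameter `l` is `f - a`, where `a` is the projection of `f` onto `dualBall l⁻¹`
(`isTikhonovMinimizer_iff`). The residual of the Tikhonov minimizer is thus the projection of `y`,
and one multiscale step projects the current residual onto a smaller ball. Everything reduces to
`IsProjection.nested`: projecting onto a large ball and then a smaller one equals projecting
directly onto the smaller one.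

This nesting is special to one dimension. Primitives can be truncated, and truncation replaces the
derivative by zero on part of the interval (`exists_primitive_eq_max`). The truncations yield a
comparison principle (`IsProjection.primitive_le`) and then a one-sided variational inequality
(`IsProjection.inner_sub_nonpos`). -/

/-! ### Primitives of square integrable functions and their truncation. -/

/-- The value at `t` of the primitive of `p` vanishing at `0`, as a continuous linear functional
of `p`. -/
noncomputable def primitive (t : ℝ) : L2 →L[ℝ] ℝ :=
  innerSL ℝ (indicatorConstLp 2 (measurableSet_Iic : MeasurableSet (Iic t))
    (measure_ne_top _ _) (1 : ℝ))

theorem L2.memLp (p : L2) : MemLp p 2 (volume.restrict (Ioo (0 : ℝ) 1)) := Lp.memLp p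

theorem L2.integrableOn (p : L2) : IntegrableOn p (Ioo 0 1) :=
  (Lp.memLp p).integrable (by norm_num)

theorem L2.intervalIntegrable (p : L2) : IntervalIntegrable p volume 0 1 := by
  rw [intervalIntegrable_iff_integrableOn_Ioo_of_le zero_le_one]
  exact p.integrableOn

theorem primitive_eq_integral (p : L2) {t : ℝ} (ht : t ∈ Icc (0 : ℝ) 1) :
    primitive t p = ∫ x in (0 : ℝ)..t, p x := by
  rw [primitive, innerSL_apply_apply, L2.inner_indicatorConstLp_one,
    Measure.restrict_restrict measurableSet_Iic, intervalIntegral.integral_of_le ht.1]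
  apply setIntegral_congr_set
  have h : Ioo (0 : ℝ) t =ᵐ[volume] Ioc 0 t := Ioo_ae_eq_Ioc
  rcases ht.2.lt_or_eq with h1 | rfl
  · have : Iic t ∩ Ioo (0 : ℝ) 1 = Ioc 0 t := by
      ext x
      simp only [mem_inter_iff, mem_Iic, mem_Ioo, mem_Ioc]
      constructor
      · rintro ⟨a, b, c⟩
        exact ⟨b, a⟩
      · rintro ⟨a, b⟩
        exact ⟨b, a, by linarith⟩
    exact this.eventuallyEq
  · have : Iic (1 : ℝ) ∩ Ioo (0 : ℝ) 1 = Ioo 0 1 := by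
      ext x
      simp only [mem_inter_iff, mem_Iic, mem_Ioo]
      constructor
      · rintro ⟨a, b, c⟩
        exact ⟨b, c⟩
      · rintro ⟨a, b⟩
        exact ⟨b.le, a, b⟩
    rw [this]
    exact h

theorem primitive_toLp {f : ℝ → ℝ} (hf : MemLp f 2 (volume.restrict (Ioo (0 : ℝ) 1))) {t : ℝ}
    (ht : t ∈ Icc (0 : ℝ) 1) : primitive t (hf.toLp f) = ∫ x in (0 : ℝ)..t, f x := by
  rw [primitive_eq_integral _ ht, intervalIntegral.integral_of_le ht.1,
    intervalIntegral.integral_of_le ht.1]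
  apply integral_congr_ae
  rw [Filter.EventuallyEq, ← Measure.restrict_congr_set (Ioo_ae_eq_Ioc (a := (0 : ℝ)) (b := t))]
  exact ae_restrict_of_ae_restrict_of_subset (Ioo_subset_Ioo_right ht.2) hf.coeFn_toLp

theorem abs_primitive_le (t : ℝ) (p : L2) : |primitive t p| ≤ ‖p‖ := by
  rw [primitive, innerSL_apply_apply]
  refine (abs_real_inner_le_norm _ _).trans (mul_le_of_le_one_left (norm_nonneg _) ?_)
  refine norm_indicatorConstLp_le.trans ?_
  rw [norm_one, one_mul]
  apply Real.rpow_le_one measureReal_nonneg _ (by positivity)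
  refine (measureReal_mono (subset_univ _)).trans ?_
  simp

/-- Composing with the positive part `x ↦ (x - c)⁺` preserves absolute continuity. -/
theorem _root_.AbsolutelyContinuousOnInterval.max_sub_const_zero {f : ℝ → ℝ} {a b : ℝ}
    (hf : AbsolutelyContinuousOnInterval f a b) (c : ℝ) :
    AbsolutelyContinuousOnInterval (fun x => max (f x - c) 0) a b := by
  rw [absolutelyContinuousOnInterval_iff] at hf ⊢
  intro ε hε
  obtain ⟨δ, hδ, h⟩ := hf ε hε
  refine ⟨δ, hδ, fun I hI hI' => lt_of_le_of_lt (Finset.sum_le_sum fun i _ => ?_) (h I hI hI')⟩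
  rw [Real.dist_eq, Real.dist_eq]
  refine (abs_max_sub_max_le_abs _ _ _).trans_eq ?_
  ring_nf

theorem deriv_max_sub_const_zero {f : ℝ → ℝ} {c f' x : ℝ} (hf : HasDerivAt f f' x) :
    deriv (fun s => max (f s - c) 0) x = f' ∨ deriv (fun s => max (f s - c) 0) x = 0 := by
  rcases lt_trichotomy (f x) c with h | h | h
  · right
    have : (fun s => max (f s - c) 0) =ᶠ[nhds x] fun _ => 0 := by
      filter_upwards [hf.continuousAt.eventually (gt_mem_nhds h)] with s hs
      exact max_eq_right (by linarith)
    rw [this.deriv_eq, deriv_const]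
  · right
    -- At the kink the truncation attains its minimum, so `deriv` is 0 whether or not it is
    -- differentiable there.
    apply IsLocalMin.deriv_eq_zero
    refine Filter.Eventually.of_forall fun s => ?_
    simp [h]
  · left
    have : (fun s => max (f s - c) 0) =ᶠ[nhds x] fun s => f s - c := by
      filter_upwards [hf.continuousAt.eventually (lt_mem_nhds h)] with s hs
      exact max_eq_left (by linarith)
    rw [this.deriv_eq]
    exact (hf.sub_const c).deriv

/-- The positive part of a shifted primitive is again a primitive, and its derivative `q`
satisfies `⟪p, q⟫ = ‖q‖²`. -/
theorem exists_primitive_eq_max (p : L2) {c : ℝ} (hc : 0 ≤ c) :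
    ∃ q : L2, (∀ t ∈ Icc (0 : ℝ) 1, primitive t q = max (primitive t p - c) 0) ∧
      ⟪p, q⟫ = ‖q‖ ^ 2 := by
  set f : ℝ → ℝ := fun t => ∫ x in (0 : ℝ)..t, p x with hfdef
  set g : ℝ → ℝ := fun t => max (f t - c) 0 with hgdef
  have hf : AbsolutelyContinuousOnInterval f 0 1 :=
    p.intervalIntegrable.absolutelyContinuousOnInterval_intervalIntegral (by simp)
  have hg : AbsolutelyContinuousOnInterval g 0 1 := hf.max_sub_const_zero c
  have hae : ∀ᵐ x ∂(volume.restrict (Ioo (0 : ℝ) 1)), deriv g x = p x ∨ deriv g x = 0 := by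
    rw [ae_restrict_iff' measurableSet_Ioo]
    filter_upwards [p.intervalIntegrable.ae_hasDerivAt_integral]
      with x h2 hx
    have hx' : x ∈ uIcc (0 : ℝ) 1 := by
      rw [uIcc_of_le zero_le_one]
      exact Ioo_subset_Icc_self hx
    exact deriv_max_sub_const_zero (h2 hx' 0 (by simp))
  have hmem : MemLp (deriv g) 2 (volume.restrict (Ioo (0 : ℝ) 1)) := by
    refine p.memLp.mono (measurable_deriv g).aestronglyMeasurable ?_
    filter_upwards [hae] with x hx
    rcases hx with h | h <;> simp [h]
  refine ⟨hmem.toLp (deriv g), fun t ht => ?_, ?_⟩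
  · have h2 := (hg.mono (c := 0) (d := t) (by
      rw [uIcc_of_le ht.1, uIcc_of_le zero_le_one]
      exact Icc_subset_Icc_right ht.2)).integral_deriv_eq_sub
    rw [primitive_toLp hmem ht, primitive_eq_integral _ ht, h2]
    have : g 0 = 0 := by simp [hgdef, hfdef, hc]
    rw [this, sub_zero]
  · rw [← real_inner_self_eq_norm_sq, L2.inner_def, L2.inner_def]
    apply integral_congr_ae
    filter_upwards [hae, hmem.coeFn_toLp] with x hx h
    rw [h]
    rcases hx with hx | hx <;> simp [hx]

/-! ### Dual balls, their projections and nesting. -/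

/-- The elements of `L²(0, 1)` with a primitive that vanishes at both endpoints and is bounded
by `μ`. -/
def dualBall (μ : ℝ) : Set L2 :=
  {p | primitive 1 p = 0 ∧ ∀ t ∈ Icc (0 : ℝ) 1, |primitive t p| ≤ μ}

/-- `a` is the metric projection of `f` onto `K`, expressed by the variational inequality. -/
def IsProjection {E : Type*} [NormedAddCommGroup E] [InnerProductSpace ℝ E] (K : Set E)
    (f a : E) : Prop :=
  a ∈ K ∧ ∀ p ∈ K, ⟪f - a, p - a⟫ ≤ 0

theorem neg_mem_dualBall {μ : ℝ} {p : L2} (hp : p ∈ dualBall μ) : -p ∈ dualBall μ := by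
  refine ⟨by simp [hp.1], fun t ht => ?_⟩
  rw [map_neg, abs_neg]
  exact hp.2 t ht

theorem smul_mem_dualBall {μ c : ℝ} (hc : 0 ≤ c) {p : L2} (hp : p ∈ dualBall μ) :
    c • p ∈ dualBall (c * μ) := by
  refine ⟨by simp [hp.1], fun t ht => ?_⟩
  rw [map_smul, smul_eq_mul, abs_mul, abs_of_nonneg hc]
  exact mul_le_mul_of_nonneg_left (hp.2 t ht) hc

theorem zero_mem_dualBall {μ : ℝ} (hμ : 0 ≤ μ) : (0 : L2) ∈ dualBall μ :=
  ⟨by simp, fun t _ => by simpa using hμ⟩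

theorem convex_dualBall (μ : ℝ) : Convex ℝ (dualBall μ) := by
  intro p hp q hq s t hs ht hst
  refine ⟨by simp [hp.1, hq.1], fun x hx => ?_⟩
  have h1 := abs_le.1 (hp.2 x hx)
  have h2 := abs_le.1 (hq.2 x hx)
  rw [map_add, map_smul, map_smul, smul_eq_mul, smul_eq_mul, abs_le]
  constructor <;> nlinarith

theorem isClosed_dualBall (μ : ℝ) : IsClosed (dualBall μ) := by
  have : dualBall μ = {p | primitive 1 p = 0} ∩
      ⋂ t ∈ Icc (0 : ℝ) 1, {p | |primitive t p| ≤ μ} := by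
    ext p
    simp [dualBall]
  rw [this]
  refine (isClosed_eq (primitive 1).continuous continuous_const).inter ?_
  exact isClosed_biInter fun t _ =>
    isClosed_le (primitive t).continuous.abs continuous_const

theorem exists_isProjection_dualBall {μ : ℝ} (hμ : 0 ≤ μ) (f : L2) :
    ∃ a, IsProjection (dualBall μ) f a := by
  obtain ⟨a, ha, h⟩ := exists_norm_eq_iInf_of_complete_convex ⟨0, zero_mem_dualBall hμ⟩
    (isClosed_dualBall μ).isComplete (convex_dualBall μ) f
  exact ⟨a, ha, (norm_eq_iInf_iff_real_inner_le_zero (convex_dualBall μ) ha).1 h⟩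

theorem IsProjection.neg_dualBall {μ : ℝ} {f a : L2} (h : IsProjection (dualBall μ) f a) :
    IsProjection (dualBall μ) (-f) (-a) := by
  refine ⟨neg_mem_dualBall h.1, fun p hp => ?_⟩
  have := h.2 (-p) (neg_mem_dualBall hp)
  rw [← inner_neg_neg]
  convert this using 2 <;> abel

/-- Comparison principle: primitives of projections onto `dualBall μ` and `dualBall μ'` differ by
at most `μ' - μ`. -/
theorem IsProjection.primitive_le {μ μ' : ℝ} (hμ : μ ≤ μ') {y a b : L2}
    (ha : IsProjection (dualBall μ) y a) (hb : IsProjection (dualBall μ') y b) {t : ℝ}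
    (ht : t ∈ Icc (0 : ℝ) 1) : primitive t b ≤ primitive t a + (μ' - μ) := by
  -- The primitive of `k` is the excess to be excluded. Both `a + k` and `b - k` stay admissible,
  -- and adding the two variational inequalities gives `‖k‖ ^ 2 ≤ 0`.
  obtain ⟨k, hk, hk'⟩ := exists_primitive_eq_max (b - a) (sub_nonneg.2 hμ)
  have h1 : (1 : ℝ) ∈ Icc (0 : ℝ) 1 := by simp
  have hk1 : primitive 1 k = 0 := by
    rw [hk 1 h1, map_sub, ha.1.1, hb.1.1]
    simpa using hμ
  have hak : a + k ∈ dualBall μ := by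
    refine ⟨by rw [map_add, ha.1.1, hk1, add_zero], fun s hs => ?_⟩
    have hA := abs_le.1 (ha.1.2 s hs)
    have hB := abs_le.1 (hb.1.2 s hs)
    rw [map_add, hk s hs, map_sub, abs_le]
    rcases max_cases (primitive s b - primitive s a - (μ' - μ)) 0 with h | h <;>
      constructor <;> linarith
  have hbk : b - k ∈ dualBall μ' := by
    refine ⟨by rw [map_sub, hb.1.1, hk1, sub_zero], fun s hs => ?_⟩
    have hA := abs_le.1 (ha.1.2 s hs)
    have hB := abs_le.1 (hb.1.2 s hs)
    rw [map_sub, hk s hs, map_sub, abs_le]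
    rcases max_cases (primitive s b - primitive s a - (μ' - μ)) 0 with h | h <;>
      constructor <;> linarith
  have e1 := ha.2 _ hak
  have e2 := hb.2 _ hbk
  rw [add_sub_cancel_left] at e1
  rw [sub_sub_cancel_left, inner_neg_right] at e2
  rw [inner_sub_left] at e1 e2 hk'
  have hk0 : k = 0 := by
    have : ‖k‖ ^ 2 ≤ 0 := by linarith
    simpa using this.antisymm (sq_nonneg _)
  have := hk t ht
  rw [hk0, map_zero, map_sub] at this
  have := le_max_left (primitive t b - primitive t a - (μ' - μ)) 0
  linarith

/-- The one-sided variational inequality behind the nesting of projections: perturbations of `a`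
pushing its primitive downwards. -/
theorem IsProjection.inner_sub_nonpos {μ μ' : ℝ} (hμ : μ ≤ μ') {y a b g : L2}
    (ha : IsProjection (dualBall μ) y a) (hb : IsProjection (dualBall μ') y b)
    (hg1 : primitive 1 g = 0)
    (hg : ∀ t ∈ Icc (0 : ℝ) 1, 0 ≤ primitive t g ∧ primitive t g ≤ primitive t a + μ) :
    ⟪a - b, g⟫ ≤ 0 := by
  -- The direction `g` itself may be inadmissible for `b`. Its primitive is capped at `1 / ε` times
  -- the slack from the comparison principle, so that `b + ε • (g - k)` is admissible; the removed
  -- part `k` costs only `O(ε)`.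
  have key : ∀ ε : ℝ, 0 < ε → ⟪a - b, g⟫ ≤ ε * (‖g‖ ^ 2 / 4) := by
    intro ε hε
    obtain ⟨k, hk, hk'⟩ := exists_primitive_eq_max (g - ε⁻¹ • (a - b))
      (div_nonneg (sub_nonneg.2 hμ) hε.le)
    have hmin : ∀ t ∈ Icc (0 : ℝ) 1, primitive t (g - k) =
        min (primitive t g) ((primitive t a - primitive t b + (μ' - μ)) / ε) := by
      intro t ht
      rw [map_sub, hk t ht, map_sub, map_smul, map_sub, smul_eq_mul]
      have : primitive t g - ε⁻¹ * (primitive t a - primitive t b) - (μ' - μ) / ε =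
        primitive t g - (primitive t a - primitive t b + (μ' - μ)) / ε := by
        field_simp
        ring
      rw [this]
      rcases le_total (primitive t g) ((primitive t a - primitive t b + (μ' - μ)) / ε) with h | h
      · rw [min_eq_left h, max_eq_right (by linarith), sub_zero]
      · rw [min_eq_right h, max_eq_left (by linarith), sub_sub_cancel]
    have h1 : primitive 1 (g - k) = 0 := by
      rw [hmin 1 (by simp), hg1, ha.1.1, hb.1.1]
      exact min_eq_left (div_nonneg (by linarith) hε.le)
    have hw : ∀ t ∈ Icc (0 : ℝ) 1, 0 ≤ primitive t (g - k) ∧ primitive t (g - k) ≤ primitive t g ∧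
        ε * primitive t (g - k) ≤ primitive t a - primitive t b + (μ' - μ) := by
      intro t ht
      have := ha.primitive_le hμ hb ht
      rw [hmin t ht]
      refine ⟨le_min (hg t ht).1 (div_nonneg (by linarith) hε.le), min_le_left _ _, ?_⟩
      rw [mul_comm, ← le_div_iff₀ hε]
      exact min_le_right _ _
    have hah : a - (g - k) ∈ dualBall μ := by
      refine ⟨by rw [map_sub, ha.1.1, h1, sub_zero], fun t ht => ?_⟩
      have hA := abs_le.1 (ha.1.2 t ht)
      have := hw t ht
      have := hg t ht
      rw [map_sub, abs_le]
      constructor <;> linarith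
    have hbh : b + ε • (g - k) ∈ dualBall μ' := by
      refine ⟨by rw [map_add, map_smul, hb.1.1, h1, smul_zero, add_zero], fun t ht => ?_⟩
      have hA := abs_le.1 (ha.1.2 t ht)
      have hB := abs_le.1 (hb.1.2 t ht)
      obtain ⟨i1, -, i3⟩ := hw t ht
      have := mul_nonneg hε.le i1
      rw [map_add, map_smul, smul_eq_mul, abs_le]
      constructor <;> linarith
    have e1 := ha.2 _ hah
    have e2 := hb.2 _ hbh
    rw [sub_sub_cancel_left, inner_neg_right] at e1
    rw [add_sub_cancel_left, inner_smul_right] at e2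
    have e2' : ⟪y - b, g - k⟫ ≤ 0 := by
      by_contra! h
      linarith [mul_pos hε h]
    have e3 : ⟪a - b, g - k⟫ ≤ 0 := by
      have : a - b = (y - b) - (y - a) := by abel
      rw [this, inner_sub_left]
      linarith
    have e4 : ⟪a - b, k⟫ = ε * (⟪g, k⟫ - ‖k‖ ^ 2) := by
      rw [inner_sub_left, real_inner_smul_left] at hk'
      rw [← hk']
      field_simp
      ring
    have e5 : ⟪g, k⟫ - ‖k‖ ^ 2 ≤ ‖g‖ ^ 2 / 4 := by
      nlinarith [real_inner_le_norm g k, sq_nonneg (‖g‖ / 2 - ‖k‖)]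
    rw [inner_sub_right] at e3
    have := mul_le_mul_of_nonneg_left e5 hε.le
    linarith
  by_contra! h
  have hC : 0 < ‖g‖ ^ 2 / 4 + 1 := by positivity
  have := key (⟪a - b, g⟫ / (‖g‖ ^ 2 / 4 + 1)) (by positivity)
  rw [div_mul_eq_mul_div, le_div_iff₀ hC] at this
  linarith

/-- Projections onto nested dual balls compose. -/
theorem IsProjection.nested {μ μ' : ℝ} (hμ : μ ≤ μ') {y a b : L2}
    (ha : IsProjection (dualBall μ) y a) (hb : IsProjection (dualBall μ') y b) :
    IsProjection (dualBall μ) b a := by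
  refine ⟨ha.1, fun p hp => ?_⟩
  -- Split `p - a` by the sign of its primitive: the negative part pushes downwards, and the
  -- positive part does so after negating everything.
  obtain ⟨g, hg, -⟩ := exists_primitive_eq_max (p - a) le_rfl
  have hmem : (1 : ℝ) ∈ Icc (0 : ℝ) 1 := by simp
  have hg1 : primitive 1 g = 0 := by
    rw [hg 1 hmem, map_sub, hp.1, ha.1.1]
    simp
  have up : ⟪-a - -b, g⟫ ≤ 0 := by
    refine ha.neg_dualBall.inner_sub_nonpos hμ hb.neg_dualBall hg1 fun t ht => ?_
    have hA := abs_le.1 (ha.1.2 t ht)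
    have hP := abs_le.1 (hp.2 t ht)
    rw [hg t ht, map_neg, map_sub, sub_zero]
    exact ⟨le_max_right _ _, max_le (by linarith) (by linarith)⟩
  have down : ⟪a - b, g - (p - a)⟫ ≤ 0 := by
    refine ha.inner_sub_nonpos hμ hb (by simp [hg1, hp.1, ha.1.1]) fun t ht => ?_
    have hA := abs_le.1 (ha.1.2 t ht)
    have hP := abs_le.1 (hp.2 t ht)
    rw [map_sub, hg t ht, map_sub, sub_zero]
    rcases max_cases (primitive t p - primitive t a) 0 with h | h <;> constructor <;> linarith
  have e : -a - -b = -(a - b) := by abel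
  rw [e, inner_neg_left] at up
  rw [inner_sub_right] at down
  rw [← neg_sub a b, inner_neg_left]
  linarith

/-! ### Smooth approximation and the dual formula for the total variation. -/

/-- The classes in `L²(0, 1)` of smooth functions with compact support in `(0, 1)`. -/
noncomputable def smoothCompact : Submodule ℝ L2 where
  carrier := {p | ∃ g : ℝ → ℝ, ContDiff ℝ ∞ g ∧ HasCompactSupport g ∧ tsupport g ⊆ Ioo 0 1 ∧
    p =ᵐ[volume.restrict (Ioo (0 : ℝ) 1)] g}
  add_mem' := by
    rintro p q ⟨f, hf1, hf2, hf3, hf4⟩ ⟨g, hg1, hg2, hg3, hg4⟩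
    exact ⟨f + g, hf1.add hg1, hf2.add hg2, (tsupport_add f g).trans (union_subset hf3 hg3),
      (Lp.coeFn_add p q).trans (hf4.add hg4)⟩
  zero_mem' := ⟨0, contDiff_const, HasCompactSupport.zero, by simp, Lp.coeFn_zero _ _ _⟩
  smul_mem' := by
    rintro c p ⟨f, hf1, hf2, hf3, hf4⟩
    refine ⟨c • f, hf1.const_smul c, hf2.smul_left (f := fun _ => c),
      (closure_mono (Function.support_const_smul_subset c f)).trans hf3,
      (Lp.coeFn_smul c p).trans (hf4.const_smul c)⟩

theorem memLp_of_hasCompactSupport {g : ℝ → ℝ} (hg : Continuous g) (hc : HasCompactSupport g) :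
    MemLp g 2 (volume.restrict (Ioo (0 : ℝ) 1)) :=
  hg.memLp_of_hasCompactSupport hc

theorem inner_toLp {g : ℝ → ℝ} (hg : MemLp g 2 (volume.restrict (Ioo (0 : ℝ) 1))) (u : L2) :
    ⟪hg.toLp g, u⟫ = ∫ x in Ioo (0 : ℝ) 1, u x * g x := by
  rw [L2.inner_def]
  apply integral_congr_ae
  filter_upwards [hg.coeFn_toLp] with x hx
  rw [hx]
  rfl

theorem dense_smoothCompact : Dense (smoothCompact : Set L2) := by
  rw [Submodule.dense_iff_topologicalClosure_eq_top, Submodule.topologicalClosure_eq_top_iff,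
    Submodule.eq_bot_iff]
  intro u hu
  have h := isOpen_Ioo.ae_eq_zero_of_integral_contDiff_smul_eq_zero (μ := volume) (f := u)
    (U := Ioo (0 : ℝ) 1) u.integrableOn.locallyIntegrableOn ?_
  · rw [← ae_restrict_iff' measurableSet_Ioo] at h
    exact Lp.eq_zero_iff_ae_eq_zero.2 h
  · intro g hg1 hg2 hg3
    have hm := memLp_of_hasCompactSupport hg1.continuous hg2
    have h0 := (Submodule.mem_orthogonal _ _).1 hu (hm.toLp g) ⟨g, hg1, hg2, hg3, hm.coeFn_toLp⟩
    rw [inner_toLp] at h0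
    refine Eq.trans ?_ h0
    rw [← setIntegral_eq_integral_of_forall_compl_eq_zero (s := Ioo (0 : ℝ) 1)]
    · simp only [smul_eq_mul, mul_comm]
    · intro x hx
      rw [image_eq_zero_of_notMem_tsupport fun hx' => hx (hg3 hx'), zero_smul]

theorem exists_smoothCompact_primitive_eq_one : ∃ r ∈ smoothCompact, primitive 1 r = 1 := by
  let ρ : ContDiffBump (1 / 2 : ℝ) := ⟨1 / 8, 1 / 4, by norm_num, by norm_num⟩
  have hs : tsupport (ρ.normed volume) ⊆ Ioo 0 1 := by
    rw [ρ.tsupport_normed_eq, Real.closedBall_eq_Icc]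
    intro x hx
    have h1 := hx.1
    have h2 := hx.2
    simp only [ρ] at h1 h2
    constructor <;> linarith
  have hm := memLp_of_hasCompactSupport ρ.continuous_normed
    (ρ.hasCompactSupport_normed (μ := volume))
  refine ⟨hm.toLp _, ⟨_, ρ.contDiff_normed, ρ.hasCompactSupport_normed, hs, hm.coeFn_toLp⟩, ?_⟩
  rw [primitive_toLp hm (by simp), intervalIntegral.integral_eq_integral_of_support_subset,
    ρ.integral_normed]
  exact (subset_tsupport _).trans (hs.trans Ioo_subset_Ioc_self)

/-- A smooth function with compact support in `(0, 1)` and mean zero has a smooth primitive with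
compact support in `(0, 1)`. -/
theorem exists_compactSupport_primitive {h : ℝ → ℝ} (h1 : ContDiff ℝ ∞ h)
    (h2 : HasCompactSupport h) (h3 : tsupport h ⊆ Ioo 0 1) (h4 : ∫ x in (0 : ℝ)..1, h x = 0) :
    ∃ φ : ℝ → ℝ, ContDiff ℝ ∞ φ ∧ HasCompactSupport φ ∧ tsupport φ ⊆ Ioo 0 1 ∧ deriv φ = h ∧
      ∀ t, φ t = ∫ x in (0 : ℝ)..t, h x := by
  have hd : ∀ t, HasDerivAt (fun t => ∫ x in (0 : ℝ)..t, h x) (h t) t := fun t =>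
    intervalIntegral.integral_hasDerivAt_right (h1.continuous.intervalIntegrable _ _)
      h1.continuous.aestronglyMeasurable.stronglyMeasurableAtFilter h1.continuous.continuousAt
  have hderiv : deriv (fun t => ∫ x in (0 : ℝ)..t, h x) = h := funext fun t => (hd t).deriv
  -- The primitive can be nonzero in gaps of the support of `h`, hence an enclosing interval.
  obtain ⟨α, β, hα, hβ, hK⟩ : ∃ α β : ℝ, 0 < α ∧ β < 1 ∧ tsupport h ⊆ Icc α β := by
    rcases (tsupport h).eq_empty_or_nonempty with h0 | hne
    · exact ⟨1 / 2, 1 / 2, by norm_num, by norm_num, by simp [h0]⟩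
    · obtain ⟨α, hα, hα'⟩ := h2.isCompact.exists_isLeast hne
      obtain ⟨β, hβ, hβ'⟩ := h2.isCompact.exists_isGreatest hne
      exact ⟨α, β, (h3 hα).1, (h3 hβ).2, fun x hx => ⟨hα' hx, hβ' hx⟩⟩
  have hz : ∀ x, x ∉ Icc α β → h x = 0 := fun x hx =>
    image_eq_zero_of_notMem_tsupport fun hx' => hx (hK hx')
  have hz' : ∀ t, t ∉ Icc α β → ∫ x in (0 : ℝ)..t, h x = 0 := by
    intro t ht
    rcases lt_or_ge t α with hlt | hge
    · refine intervalIntegral.integral_zero_ae (Filter.Eventually.of_forall fun x hx => hz x ?_)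
      intro hx'
      have := (uIoc_subset_uIcc hx).2
      have := max_lt hα hlt
      linarith [hx'.1]
    · have hgt : β < t := by
        by_contra! hle
        exact ht ⟨hge, hle⟩
      rw [← intervalIntegral.integral_add_adjacent_intervals
        (h1.continuous.intervalIntegrable 0 1) (h1.continuous.intervalIntegrable 1 t), h4, zero_add]
      refine intervalIntegral.integral_zero_ae (Filter.Eventually.of_forall fun x hx => hz x ?_)
      intro hx'
      have := (uIoc_subset_uIcc hx).1
      have := lt_min hβ hgt
      linarith [hx'.2]
  have hsub : tsupport (fun t => ∫ x in (0 : ℝ)..t, h x) ⊆ Icc α β := by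
    refine closure_minimal (fun x hx => ?_) isClosed_Icc
    by_contra hx'
    exact hx (hz' x hx')
  refine ⟨fun t => ∫ x in (0 : ℝ)..t, h x, ?_, ?_, ?_, hderiv, fun _ => rfl⟩
  · rw [contDiff_infty_iff_deriv, hderiv]
    exact ⟨fun t => (hd t).differentiableAt, h1⟩
  · exact HasCompactSupport.intro isCompact_Icc hz'
  · exact hsub.trans fun x hx => ⟨hα.trans_le hx.1, hx.2.trans_lt hβ⟩

theorem IsTestFunction.memLp_deriv {φ : ℝ → ℝ} (h : IsTestFunction φ) :
    MemLp (deriv φ) 2 (volume.restrict (Ioo (0 : ℝ) 1)) :=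
  memLp_of_hasCompactSupport (h.1.continuous_deriv (by simp)) h.2.1.deriv

theorem IsTestFunction.toLp_deriv_mem_dualBall {φ : ℝ → ℝ} (h : IsTestFunction φ) :
    h.memLp_deriv.toLp _ ∈ dualBall 1 := by
  have hz : ∀ x ∉ Ioo (0 : ℝ) 1, φ x = 0 := fun x hx =>
    image_eq_zero_of_notMem_tsupport fun hx' => hx (h.2.2.1 hx')
  have key : ∀ t ∈ Icc (0 : ℝ) 1, primitive t (h.memLp_deriv.toLp _) = φ t := by
    intro t ht
    rw [primitive_toLp _ ht, intervalIntegral.integral_deriv_eq_sub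
      (fun x _ => (h.1.differentiable (by simp)).differentiableAt)
      ((h.1.continuous_deriv (by simp)).intervalIntegrable _ _), hz 0 (by simp), sub_zero]
  refine ⟨by rw [key 1 (by simp), hz 1 (by simp)], fun t ht => ?_⟩
  rw [key t ht]
  exact h.2.2.2 t

/-- A multiple of a mean-zero smooth approximation of an element of the unit dual ball is the
derivative of a test function. -/
theorem exists_isTestFunction_of_smoothCompact {p q : L2} (hp : p ∈ dualBall 1)
    (hq : q ∈ smoothCompact) (hq1 : primitive 1 q = 0) :
    ∃ φ, ∃ h : IsTestFunction φ, h.memLp_deriv.toLp _ = (1 + ‖q - p‖)⁻¹ • q := by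
  obtain ⟨g, hg1, hg2, hg3, hg4⟩ := hq
  have hm := memLp_of_hasCompactSupport hg1.continuous hg2
  have hqg : q = hm.toLp g := Lp.ext (hg4.trans hm.coeFn_toLp.symm)
  have hprim : ∀ t ∈ Icc (0 : ℝ) 1, primitive t q = ∫ x in (0 : ℝ)..t, g x := fun t ht => by
    rw [hqg, primitive_toLp hm ht]
  obtain ⟨φ, hφ1, hφ2, hφ3, hφ4, hφ5⟩ := exists_compactSupport_primitive hg1 hg2 hg3
    ((hprim 1 (by simp)).symm.trans hq1)
  -- The primitive of `q` is at most `1 + ‖q - p‖` by `abs_primitive_le`; `c` restores the bound 1.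
  set c : ℝ := (1 + ‖q - p‖)⁻¹ with hc
  have hpos : 0 < 1 + ‖q - p‖ := by positivity
  have hderiv : deriv (c • φ) = c • g := by
    rw [← hφ4]
    ext x
    exact deriv_const_smul c (hφ1.differentiable (by simp)).differentiableAt
  have htest : IsTestFunction (c • φ) := by
    refine ⟨hφ1.const_smul c, hφ2.smul_left (f := fun _ => c),
      (closure_mono (Function.support_const_smul_subset c φ)).trans hφ3, fun x => ?_⟩
    rw [Pi.smul_apply, smul_eq_mul, abs_mul, hc, abs_inv, abs_of_pos hpos,
      inv_mul_le_iff₀ hpos, mul_one]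
    by_cases hx : x ∈ Icc (0 : ℝ) 1
    · have e1 := hp.2 x hx
      have e2 := abs_primitive_le x (q - p)
      have e3 : φ x = primitive x p + primitive x (q - p) := by
        rw [hφ5, ← hprim x hx, map_sub]
        ring
      rw [e3]
      exact (abs_add_le _ _).trans (add_le_add e1 e2)
    · rw [image_eq_zero_of_notMem_tsupport fun hx' => hx (Ioo_subset_Icc_self (hφ3 hx')), abs_zero]
      exact hpos.le
  refine ⟨c • φ, htest, Lp.ext ?_⟩
  refine htest.memLp_deriv.coeFn_toLp.trans ?_
  rw [hderiv]
  exact ((Lp.coeFn_smul c q).trans (hg4.const_smul c)).symm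

/-- The map `F` corrects the mean using `r` and then rescales. It is continuous, fixes `p` and sends
the dense smooth class to derivatives of test functions. -/
theorem dualBall_one_subset_closure :
    dualBall 1 ⊆ closure {q | ∃ φ, ∃ h : IsTestFunction φ, h.memLp_deriv.toLp _ = q} := by
  intro p hp
  obtain ⟨r, hr, hr1⟩ := exists_smoothCompact_primitive_eq_one
  let P : L2 → L2 := fun g => g - primitive 1 g • r
  let F : L2 → L2 := fun g => (1 + ‖P g - p‖)⁻¹ • P g
  have hP : Continuous P :=
    continuous_id.sub ((primitive 1).continuous.smul continuous_const)
  have hF : Continuous F := by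
    refine Continuous.smul (Continuous.inv₀
      (continuous_const.add (hP.sub continuous_const).norm) fun g => ?_) hP
    change 1 + ‖P g - p‖ ≠ 0
    positivity
  have hFp : F p = p := by simp [F, P, hp.1]
  rw [← hFp]
  refine map_mem_closure hF (dense_smoothCompact p) fun g hg => ?_
  refine exists_isTestFunction_of_smoothCompact hp
    (smoothCompact.sub_mem hg (smoothCompact.smul_mem _ hr)) ?_
  rw [map_sub, map_smul, hr1, smul_eq_mul, mul_one, sub_self]

theorem ofReal_inner_le_totalVariation {p : L2} (hp : p ∈ dualBall 1) (u : L2) :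
    ENNReal.ofReal ⟪p, u⟫ ≤ totalVariation u := by
  have hcl : IsClosed {p : L2 | ENNReal.ofReal ⟪p, u⟫ ≤ totalVariation u} :=
    isClosed_le (ENNReal.continuous_ofReal.comp (continuous_id.inner continuous_const))
      continuous_const
  refine closure_minimal ?_ hcl (dualBall_one_subset_closure hp)
  rintro _ ⟨φ, h, rfl⟩
  rw [mem_ofPred_eq, inner_toLp]
  exact le_iSup (fun φ : {φ : ℝ → ℝ // IsTestFunction φ} =>
    ENNReal.ofReal (∫ x in Ioo (0 : ℝ) 1, u x * deriv φ.1 x)) ⟨φ, h⟩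

theorem totalVariation_le_ofReal {u : L2} {c : ℝ} (h : ∀ p ∈ dualBall 1, ⟪p, u⟫ ≤ c) :
    totalVariation u ≤ ENNReal.ofReal c := by
  refine iSup_le fun φ => ENNReal.ofReal_le_ofReal ?_
  rw [← inner_toLp φ.2.memLp_deriv]
  exact h _ φ.2.toLp_deriv_mem_dualBall

/-! ### Tikhonov minimizers and multiscale iterates. -/

/-- The minimizer of the Tikhonov functional is the residual of the projection of the data onto
the dual ball of radius `1 / l`. -/
theorem isTikhonovMinimizer_iff {l : ℝ} (hl : 0 < l) {f a : L2}
    (ha : IsProjection (dualBall l⁻¹) f a) (u : L2) :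
    IsTikhonovMinimizer (ContinuousLinearMap.id ℝ L2) totalVariation l f u ↔ u = f - a := by
  have hla : l • a ∈ dualBall 1 := by
    simpa [hl.ne'] using smul_mem_dualBall hl.le ha.1
  have hsup : ∀ p ∈ dualBall 1, ⟪p, f - a⟫ ≤ ⟪l • a, f - a⟫ := by
    intro p hp
    have h := ha.2 (l⁻¹ • p) (by simpa using smul_mem_dualBall (inv_nonneg.2 hl.le) hp)
    rw [real_inner_comm, inner_sub_left, real_inner_smul_left, sub_nonpos,
      inv_mul_le_iff₀ hl] at h
    rwa [real_inner_smul_left]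
  have hnn : 0 ≤ ⟪l • a, f - a⟫ := by
    simpa using hsup 0 (zero_mem_dualBall zero_le_one)
  -- Bounding the total variation below by the pairing with `l • a` and completing the square leaves
  -- a quadratic with sole minimizer `f - a`, where the bound is attained.
  have hlow : ∀ w : L2, ENNReal.ofReal (l / 2 * ‖a‖ ^ 2 + ⟪l • a, f - a⟫ +
      l / 2 * ‖w - (f - a)‖ ^ 2) ≤
      tikhonov (ContinuousLinearMap.id ℝ L2) totalVariation l f w := by
    intro w
    have e : l / 2 * ‖a‖ ^ 2 + ⟪l • a, f - a⟫ + l / 2 * ‖w - (f - a)‖ ^ 2 =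
        l / 2 * ‖w - f‖ ^ 2 + ⟪l • a, w⟫ := by
      have e1 : w - (f - a) = (w - f) + a := by abel
      have e2 : f - a = w - ((w - f) + a) := by abel
      rw [e1, norm_add_sq_real, e2, real_inner_smul_left, real_inner_smul_left, inner_sub_right,
        inner_add_right, real_inner_self_eq_norm_sq, real_inner_comm a (w - f)]
      ring
    rw [e]
    exact ENNReal.ofReal_add_le.trans
      (add_le_add le_rfl (ofReal_inner_le_totalVariation hla w))
  have hup : tikhonov (ContinuousLinearMap.id ℝ L2) totalVariation l f (f - a) ≤
      ENNReal.ofReal (l / 2 * ‖a‖ ^ 2 + ⟪l • a, f - a⟫) := by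
    rw [ENNReal.ofReal_add (by positivity) hnn]
    refine add_le_add (le_of_eq ?_) (totalVariation_le_ofReal hsup)
    simp
  constructor
  · intro hu
    have h := (hlow u).trans ((hu _).trans hup)
    rw [ENNReal.ofReal_le_ofReal_iff (by positivity)] at h
    have h0 : ‖u - (f - a)‖ ^ 2 ≤ 0 := by
      by_contra! hc
      nlinarith [mul_pos hl hc]
    have : ‖u - (f - a)‖ = 0 := by simpa using h0.antisymm (sq_nonneg _)
    exact sub_eq_zero.1 (norm_eq_zero.1 this)
  · rintro rfl w
    refine hup.trans (le_trans (ENNReal.ofReal_le_ofReal ?_) (hlow w))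
    have : 0 ≤ l / 2 * ‖w - (f - a)‖ ^ 2 := by positivity
    linarith

theorem iterate_succ {X : Type*} [NormedAddCommGroup X] [NormedSpace ℝ X] (u : ℕ → X) (n : ℕ) :
    iterate u (n + 1) = iterate u n + u (n + 1) :=
  Finset.sum_range_succ _ _

/-- If `a n` is the projection of the data onto the dual ball of radius `1 / lam n`, then the
multiscale components are `y - a 0` and the differences `a n - a (n + 1)`. -/
theorem isDecomposition_iff {y : L2} {lam : ℕ → ℝ} (hpos : ∀ n, 0 < lam n) (hmono : Monotone lam)
    {a : ℕ → L2} (ha : ∀ n, IsProjection (dualBall (lam n)⁻¹) y (a n)) (u : ℕ → L2) :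
    IsDecomposition (ContinuousLinearMap.id ℝ L2) totalVariation lam y u ↔
      ∀ n, iterate u n = y - a n := by
  -- The residual after step `n` is `a n`; by nesting its projection onto the next, smaller ball is
  -- `a (n + 1)`.
  have hstep : ∀ n w, IsTikhonovMinimizer (ContinuousLinearMap.id ℝ L2) totalVariation
      (lam (n + 1)) (a n) w ↔ w = a n - a (n + 1) := fun n w =>
    isTikhonovMinimizer_iff (hpos _) ((ha (n + 1)).nested
      (inv_anti₀ (hpos n) (hmono n.le_succ)) (ha n)) w
  constructor
  · intro h n
    induction n with
    | zero => simpa [iterate] using (isTikhonovMinimizer_iff (hpos 0) (ha 0) _).1 h.zero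
    | succ n ih =>
      have := h.succ n
      rw [ih, ContinuousLinearMap.id_apply, sub_sub_cancel, hstep] at this
      rw [iterate_succ, ih, this]
      abel
  · intro h
    refine ⟨(isTikhonovMinimizer_iff (hpos 0) (ha 0) _).2 (by simpa [iterate] using h 0),
      fun n => ?_⟩
    have h1 := h (n + 1)
    rw [iterate_succ, h n] at h1
    rw [h n, ContinuousLinearMap.id_apply, sub_sub_cancel, hstep, ← sub_eq_iff_eq_add'.2 h1.symm]
    abel

end MHDM

theorem mainTheorem7 (y : MHDM.L2) (lam : ℕ → ℝ) (hpos : ∀ n, 0 < lam n) (hmono : Monotone lam) :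
    (∀ n, ∃! x : MHDM.L2, MHDM.IsTikhonovMinimizer (ContinuousLinearMap.id ℝ MHDM.L2)
        MHDM.totalVariation (lam n) y x) ∧
    (∃! u : ℕ → MHDM.L2, MHDM.IsDecomposition (ContinuousLinearMap.id ℝ MHDM.L2)
        MHDM.totalVariation lam y u) ∧
    ∀ (u : ℕ → MHDM.L2) (x : ℕ → MHDM.L2),
      MHDM.IsDecomposition (ContinuousLinearMap.id ℝ MHDM.L2) MHDM.totalVariation lam y u →
      (∀ n, MHDM.IsTikhonovMinimizer (ContinuousLinearMap.id ℝ MHDM.L2)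
        MHDM.totalVariation (lam n) y (x n)) →
      ∀ n, MHDM.iterate u n = x n := by
  choose a ha using fun n => MHDM.exists_isProjection_dualBall (inv_nonneg.2 (hpos n).le) y
  have hmin := fun n => MHDM.isTikhonovMinimizer_iff (hpos n) (ha n)
  have hdec := MHDM.isDecomposition_iff hpos hmono ha
  refine ⟨fun n => ⟨y - a n, (hmin n _).2 rfl, fun x hx => (hmin n x).1 hx⟩, ?_, ?_⟩
  · refine ⟨fun n => Nat.casesOn n (y - a 0) fun k => a k - a (k + 1), (hdec _).2 fun n => ?_,
      fun v hv => ?_⟩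
    · induction n with
      | zero => simp [MHDM.iterate]
      | succ n ih =>
        rw [MHDM.iterate_succ, ih]
        simp
    · have h := (hdec v).1 hv
      funext n
      cases n with
      | zero => simpa [MHDM.iterate] using h 0
      | succ n =>
        have h1 := h (n + 1)
        rw [MHDM.iterate_succ, h n] at h1
        rw [← sub_eq_iff_eq_add'.2 h1.symm]
        simp
  · intro u x hu hx n
    rw [(hdec u).1 hu n, (hmin n _).1 (hx n)]
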